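/- Let $\kappa>0$, put $D_\kappa=\pi/\sqrt{\kappa}$ and $\cos_\kappa a=\cos(\sqrt{\kappa}\,a)$, and let $\mathbb{M}^2(\kappa)$ be the 2-dimensional sphere of constant curvature $\kappa$. A geodesic in a metric space $(X,d)$ is a curve $\gamma:[0,1]\to X$ for which there is a constant $v\ge 0$ with $d(\gamma(s),\gamma(t))=v|s-t|$ for all $s,t\in[0,1]$. A real function $f$ on a metric space is called convex if $f\circ\gamma:[0,1]\to\mathbb{R}$ is convex for every geodesic $\gamma$ of that space. The space $(X,d)$ is a $\mathrm{CAT}(\kappa)$ space if any two points at distance less than $D_\kappa$ are joined by a geodesic and if, for every geodesic triangle $\Delta$ in $X$ of perimeter less than $2D_\kappa$, for every comparison triangle $\bar\Delta$ in $\mathbb{M}^2(\kappa)$ (a geodesic triangle with the same side lengths), and for all points $x,y$ on $\Delta$ with corresponding points $\bar x,\bar y$ on $\bar\Delta$, one has $d(x,y)\le d_{\mathbb{M}^2(\kappa)}(\bar x,\bar y)$. Theorem. Let $(X,d)$ be a complete $\mathrm{CAT}(\kappa)$ space, let $o\in X$, and let $B=\overline{B}_r(o)$ be the closed ball of radius $r<D_\kappa/4$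 centered at $o$. Then $\cos_\kappa d(x,o)\,\cos_\kappa d(y,o)-\tfrac12>0$ for all $x,y\in B$, and the function $$\Phi: B\times B\to[0,\infty),\qquad \Phi(x,y)=\frac{1-\cos_\kappa d(x,y)}{\sqrt{\cos_\kappa d(x,o)\,\cos_\kappa d(y,o)-\tfrac12}},$$ is well defined, nonnegative and convex, where $B\times B$ carries the product metric $\sqrt{d(x,x')^2+d(y,y')^2}$. -/

import Mathlib

noncomputable section

/-- `γ` restricted to `[0, 1]` is a geodesic for the distance function `d`: it has constant speed,
`d (γ s) (γ t) = v * |s - t|` for all `s, t ∈ [0, 1]`. The values of `γ` outside `[0, 1]` are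
irrelevant. -/
def IsGeodesicFor {M : Type*} (d : M → M → ℝ) (γ : ℝ → M) : Prop :=
  ∃ v : ℝ, 0 ≤ v ∧ ∀ s ∈ Set.Icc (0 : ℝ) 1, ∀ t ∈ Set.Icc (0 : ℝ) 1,
    d (γ s) (γ t) = v * |s - t|

/-- Geodesics `[0, 1] → X` of a metric space `X`. -/
def IsGeodesic {X : Type*} [MetricSpace X] (γ : ℝ → X) : Prop :=
  IsGeodesicFor (fun x y : X => dist x y) γ

/-- A function on a metric space is geodesically convex if its composition with every geodesic
`[0, 1] → X` is convex. -/
def GeodesicallyConvex {X : Type*} [MetricSpace X] (f : X → ℝ) : Prop :=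
  ∀ γ : ℝ → X, IsGeodesic γ → ConvexOn ℝ (Set.Icc (0 : ℝ) 1) (fun t => f (γ t))

/-- The diameter `D_κ = π / √κ` of the model space of constant curvature `κ > 0`. -/
def modelDiam (κ : ℝ) : ℝ := Real.pi / √κ

/-- The points of the model surface `𝕄²(κ)`, `κ > 0`: the unit sphere in `ℝ³`. -/
abbrev ModelSphere : Type := Metric.sphere (0 : EuclideanSpace ℝ (Fin 3)) 1

/-- The distance of `𝕄²(κ)`, `κ > 0`: the angular distance of the unit sphere, scaled by
`1 / √κ`. -/
def modelDist (κ : ℝ) (x y : ModelSphere) : ℝ :=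
  InnerProductGeometry.angle (x : EuclideanSpace ℝ (Fin 3)) (y : EuclideanSpace ℝ (Fin 3)) / √κ

/-- A triangle whose sides are geodesics for the distance function `d`: vertices
`vertex 0, vertex 1, vertex 2`, and for each `i` (modulo 3) a geodesic `side i : [0, 1] → M` from
`vertex i` to `vertex (i + 1)`. -/
structure GeodesicTriangle {M : Type*} (d : M → M → ℝ) where
  vertex : Fin 3 → M
  side : Fin 3 → ℝ → M
  isGeodesic_side : ∀ i, IsGeodesicFor d (side i)
  side_zero : ∀ i, side i 0 = vertex i
  side_one : ∀ i, side i 1 = vertex (i + 1)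

/-- The perimeter of a geodesic triangle. -/
def GeodesicTriangle.perimeter {M : Type*} {d : M → M → ℝ} (T : GeodesicTriangle d) : ℝ :=
  ∑ i : Fin 3, d (T.vertex i) (T.vertex (i + 1))

/-- For `κ > 0`: `X` is a `CAT(κ)` space. Any two points at distance `< D_κ` are joined by a
geodesic, and for every geodesic triangle `T` of perimeter `< 2 D_κ` and every comparison triangle
`T'` in `𝕄²(κ)` (same side lengths), distances between points of `T` are at most the distances
between the corresponding points of `T'`. Since sides have constant speed, the point corresponding
to `T.side i s` is `T'.side i s`. -/
structure IsCAT (κ : ℝ) (X : Type*) [MetricSpace X] : Prop where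
  exists_geodesic : ∀ x y : X, dist x y < modelDiam κ →
    ∃ γ : ℝ → X, IsGeodesic γ ∧ γ 0 = x ∧ γ 1 = y
  comparison : ∀ (T : GeodesicTriangle (fun x y : X => dist x y))
    (T' : GeodesicTriangle (modelDist κ)),
    T.perimeter < 2 * modelDiam κ →
    (∀ i, modelDist κ (T'.vertex i) (T'.vertex (i + 1)) = dist (T.vertex i) (T.vertex (i + 1))) →
    ∀ i j, ∀ s ∈ Set.Icc (0 : ℝ) 1, ∀ t ∈ Set.Icc (0 : ℝ) 1,
      dist (T.side i s) (T.side j t) ≤ modelDist κ (T'.side i s) (T'.side j t)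

/-- `cos_κ a = cos (√κ a)`. -/
def cosK (κ a : ℝ) : ℝ := Real.cos (√κ * a)

/-- `Φ(x, y) = (1 - cos_κ d(x, y)) / √(cos_κ d(x, o) cos_κ d(y, o) - 1/2)`. -/
def convexReplacement {X : Type*} [MetricSpace X] (κ : ℝ) (o x y : X) : ℝ :=
  (1 - cosK κ (dist x y)) / √(cosK κ (dist x o) * cosK κ (dist y o) - 1 / 2)

end

/-!
Take `κ = 1`; in general `√κ` rescales all distances. Write `D = cos d` and `s = sin (d / 2)` (half
the chord of an arc of length `d`), so that the function is `2 s² / c` with numerator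
`2 s² = 1 - D(x, y)` and denominator `c = √(D(x, o) D(y, o) - 1 / 2)`.

Geodesics of the `ℓ²` product are pairs of geodesics (`IsGeodesic.fst_snd`), and a continuous
function is convex once it is midpoint convex (`convexOn_Icc_of_midpoint`). So let `α`, `β` be
geodesics in the ball, `a`, `b` the cosines of half their lengths, `C = a b`, and let the indices
`0`, `m`, `1` refer to the start, the middle and the end of both. The theorem follows from
`4 C s_m² ≤ (s₀ + s₁)²`, from `2 C c_m ≥ c₀ + c₁` and from
`(s₀ + s₁)² / (c₀ + c₁) ≤ s₀² / c₀ + s₁² / c₁`.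

* Comparison with an explicit spherical triangle (`IsCAT.cosK_dist_geodesic`) bounds `D(w, γ t)`
  from below by the spherical interpolation of `D(w, γ 0)` and `D(w, γ 1)`.
* Lower bound for `c_m` (`add_sqrt_le_of_midpoint`): the comparison gives
  `2 a D(α_m, o) ≥ D(α₀, o) + D(α₁, o)` and likewise for `β`; the rest is algebra, which uses that
  `D ≤ 1` and that the products `D(α_i, o) D(β_i, o)` are at least `1 / 2`.
* Upper bound for `s_m` (`IsCAT.halfChord_midpoint_sq_le`): applying the comparison three times,
  `4 C D(α_m, β_m)` is at least the sum of the four `D(α_i, β_j)`. The diagonal terms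
  `D(α₀, β₁) + D(α₁, β₀)` are bounded from below by the sides (`IsCAT.quadrilateral`). On the sphere
  this is the Cauchy–Schwarz inequality for the chords `α₀ - β₀` and `α₁ - β₁`; in a CAT space it
  is obtained from the triangle inequality through the point that divides one diagonal in the ratio
  of the chords `α₀β₀` and `α₁β₁`.
-/

/-! ### Convexity and geodesics -/

/-- A continuous midpoint convex function on `[0, 1]` is convex: an excess of `f` over one of its
chords attains its maximum, and a first maximum in the interior violates midpoint convexity. -/
theorem convexOn_Icc_of_midpoint {f : ℝ → ℝ} (hc : ContinuousOn f (Set.Icc 0 1))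
    (hm : ∀ x ∈ Set.Icc (0 : ℝ) 1, ∀ y ∈ Set.Icc (0 : ℝ) 1, f ((x + y) / 2) ≤ (f x + f y) / 2) :
    ConvexOn ℝ (Set.Icc (0 : ℝ) 1) f := by
  refine LinearOrder.convexOn_of_lt (convex_Icc 0 1) ?_
  intro x hx y hy hxy a b ha hb hab
  simp only [smul_eq_mul]
  by_contra! hlt
  set k : ℝ := (f y - f x) / (y - x) with hk
  have hyx : 0 < y - x := sub_pos.2 hxy
  have hk' : k * (y - x) = f y - f x := div_mul_cancel₀ _ hyx.ne'
  set g : ℝ → ℝ := fun t => f t - f x - k * (t - x) with hg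
  have hsub : Set.Icc x y ⊆ Set.Icc 0 1 := Set.Icc_subset_Icc hx.1 hy.2
  have hgc : ContinuousOn g (Set.Icc x y) := by
    have := hc.mono hsub
    fun_prop
  have hgx : g x = 0 := by simp [hg]
  have hgy : g y = 0 := by simp only [hg]; linarith
  have hpmem : a * x + b * y ∈ Set.Icc x y := by
    have : a = 1 - b := by linarith
    subst this
    constructor <;> nlinarith
  have hgp : 0 < g (a * x + b * y) := by
    have : a * x + b * y - x = b * (y - x) := by
      have : a = 1 - b := by linarith
      subst this; ring
    simp only [hg, this]
    have h2 : k * (b * (y - x)) = b * (f y - f x) := by rw [← hk']; ring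
    have h3 : a * f x + b * f y - f x = b * (f y - f x) := by
      have : a = 1 - b := by linarith
      subst this; ring
    linarith
  obtain ⟨c₀, hc₀, hmax⟩ := isCompact_Icc.exists_isMaxOn (Set.nonempty_Icc.2 hxy.le) hgc
  have hKc : IsCompact (Set.Icc x y ∩ g ⁻¹' {g c₀}) :=
    isCompact_Icc.of_isClosed_subset
      (hgc.preimage_isClosed_of_isClosed isClosed_Icc isClosed_singleton) Set.inter_subset_left
  obtain ⟨c, ⟨hcI, hcg⟩, hleast⟩ := hKc.exists_isLeast ⟨c₀, hc₀, rfl⟩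
  simp only [Set.mem_preimage, Set.mem_singleton_iff] at hcg
  have hpos : 0 < g c := by rw [hcg]; exact hgp.trans_le (hmax hpmem)
  have hxc : x < c := lt_of_le_of_ne hcI.1 (by rintro rfl; linarith)
  have hcy : c < y := lt_of_le_of_ne hcI.2 (by rintro rfl; linarith)
  obtain ⟨δ, hδ, hδ1, hδ2⟩ : ∃ δ : ℝ, 0 < δ ∧ δ ≤ c - x ∧ δ ≤ y - c :=
    ⟨min (c - x) (y - c), lt_min (by linarith) (by linarith), min_le_left _ _, min_le_right _ _⟩
  have hm1 : c - δ ∈ Set.Icc x y := ⟨by linarith, by linarith⟩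
  have hm2 : c + δ ∈ Set.Icc x y := ⟨by linarith, by linarith⟩
  have h1 : g (c - δ) < g c := by
    refine lt_of_le_of_ne (by rw [hcg]; exact hmax hm1) fun h => ?_
    have := hleast ⟨hm1, by simpa [hcg] using h⟩
    linarith
  have h2 : g (c + δ) ≤ g c := by rw [hcg]; exact hmax hm2
  have h3 := hm _ (hsub hm1) _ (hsub hm2)
  rw [show (c - δ + (c + δ)) / 2 = c by ring] at h3
  simp only [hg] at h1 h2
  linarith

theorem IsGeodesic.reparam {X : Type*} [MetricSpace X] {γ : ℝ → X} (hγ : IsGeodesic γ)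
    {x y : ℝ} (hx : x ∈ Set.Icc (0 : ℝ) 1) (hy : y ∈ Set.Icc (0 : ℝ) 1) :
    IsGeodesic (fun t => γ (x + t * (y - x))) := by
  obtain ⟨v, hv, h⟩ := hγ
  have hmem : ∀ t ∈ Set.Icc (0 : ℝ) 1, x + t * (y - x) ∈ Set.Icc (0 : ℝ) 1 := by
    rintro t ⟨h0, h1⟩
    have := (convex_Icc (0 : ℝ) 1) hx hy (sub_nonneg.2 h1) h0 (by ring)
    convert this using 1
    simp only [smul_eq_mul]; ring
  refine ⟨v * |y - x|, by positivity, fun s hs t ht => ?_⟩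
  rw [h _ (hmem s hs) _ (hmem t ht), mul_assoc, ← abs_mul]
  congr 2; ring

theorem IsGeodesic.dist_eq {X : Type*} [MetricSpace X] {γ : ℝ → X} (hγ : IsGeodesic γ)
    {s t : ℝ} (hs : s ∈ Set.Icc (0 : ℝ) 1) (ht : t ∈ Set.Icc (0 : ℝ) 1) :
    dist (γ s) (γ t) = dist (γ 0) (γ 1) * |s - t| := by
  obtain ⟨v, hv, h⟩ := hγ
  have h1 := h 0 (by simp) 1 (by simp)
  have h2 := h s hs t ht
  dsimp only at h1 h2
  rw [h1, h2]; simp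

theorem IsGeodesic.continuousOn {X : Type*} [MetricSpace X] {γ : ℝ → X} (hγ : IsGeodesic γ) :
    ContinuousOn γ (Set.Icc 0 1) := by
  have : LipschitzOnWith ⟨dist (γ 0) (γ 1), dist_nonneg⟩ γ (Set.Icc 0 1) :=
    LipschitzOnWith.of_dist_le_mul fun s hs t ht => by
      rw [hγ.dist_eq hs ht, Real.dist_eq]; rfl
  exact this.continuousOn

/-- Two functions satisfying the triangle inequality whose `ℓ²` combination is proportional to
`t - s` are both proportional to `t - s`: equality holds in the triangle inequality of the plane. -/
theorem affine_of_sq_add_sq {f g : ℝ → ℝ → ℝ} {v : ℝ} (hf0 : ∀ s t, 0 ≤ f s t)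
    (hg0 : ∀ s t, 0 ≤ g s t) (hf : ∀ s m t, f s t ≤ f s m + f m t)
    (hg : ∀ s m t, g s t ≤ g s m + g m t)
    (h : ∀ s t, 0 ≤ s → s ≤ t → t ≤ 1 → f s t ^ 2 + g s t ^ 2 = (v * (t - s)) ^ 2)
    {s t : ℝ} (hs : 0 ≤ s) (hst : s ≤ t) (ht : t ≤ 1) :
    f s t = f 0 1 * (t - s) := by
  have key : ∀ s m t : ℝ, 0 ≤ s → s ≤ m → m ≤ t → t ≤ 1 →
      f s t = f s m + f m t ∧ f m t * (m - s) = f s m * (t - m) := by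
    intro s m t h0 h1 h2 h3
    have e1 := h s m h0 h1 (h2.trans h3)
    have e2 := h m t (h0.trans h1) h2 h3
    have e3 := h s t h0 (h1.trans h2) h3
    have hp : 0 ≤ m - s := by linarith
    have hq : 0 ≤ t - m := by linarith
    have cs : f s m * f m t + g s m * g m t ≤ v ^ 2 * ((m - s) * (t - m)) := by
      refine abs_le_of_sq_le_sq' ?_ (by positivity) |>.2
      have : (v ^ 2 * ((m - s) * (t - m))) ^ 2
          = (f s m ^ 2 + g s m ^ 2) * (f m t ^ 2 + g m t ^ 2) := by rw [e1, e2]; ring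
      rw [this]
      nlinarith [sq_nonneg (f s m * g m t - g s m * f m t)]
    have tf : f s t ^ 2 ≤ (f s m + f m t) ^ 2 := pow_le_pow_left₀ (hf0 _ _) (hf s m t) 2
    have tg : g s t ^ 2 ≤ (g s m + g m t) ^ 2 := pow_le_pow_left₀ (hg0 _ _) (hg s m t) 2
    have eqf : f s t ^ 2 = (f s m + f m t) ^ 2 := by nlinarith
    have eqc : f s m * f m t + g s m * g m t = v ^ 2 * ((m - s) * (t - m)) := by nlinarith
    refine ⟨(pow_left_inj₀ (hf0 _ _) (add_nonneg (hf0 _ _) (hf0 _ _)) two_ne_zero).1 eqf, ?_⟩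
    have hz : (f m t * (m - s) - f s m * (t - m)) ^ 2
        + (g m t * (m - s) - g s m * (t - m)) ^ 2 = 0 := by
      linear_combination (m - s) ^ 2 * e2 + (t - m) ^ 2 * e1 - 2 * (m - s) * (t - m) * eqc
    have := (add_eq_zero_iff_of_nonneg (sq_nonneg _) (sq_nonneg _)).1 hz
    exact sub_eq_zero.1 (pow_eq_zero_iff two_ne_zero |>.1 this.1)
  have h0 : ∀ m : ℝ, 0 ≤ m → m ≤ 1 → f 0 m = m * f 0 1 := by
    intro m h0 h1
    obtain ⟨k1, k2⟩ := key 0 m 1 le_rfl h0 h1 le_rfl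
    linear_combination (-m) * k1 - k2
  have k := (key 0 s t le_rfl hs hst ht).1
  rw [h0 t (hs.trans hst) ht, h0 s hs (hst.trans ht)] at k
  linear_combination -k

theorem isGeodesic_of_sorted {X : Type*} [MetricSpace X] {γ : ℝ → X} {v : ℝ} (hv : 0 ≤ v)
    (h : ∀ s t : ℝ, 0 ≤ s → s ≤ t → t ≤ 1 → dist (γ s) (γ t) = v * (t - s)) : IsGeodesic γ := by
  refine ⟨v, hv, fun s hs t ht => ?_⟩
  dsimp only
  rcases le_total s t with hst | hst
  · rw [h s t hs.1 hst ht.2, abs_sub_comm, abs_of_nonneg (sub_nonneg.2 hst)]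
  · rw [dist_comm, h t s ht.1 hst hs.2, abs_of_nonneg (sub_nonneg.2 hst)]

theorem prod_dist_sq_eq_of_L2 {X Y : Type*} [MetricSpace X] [MetricSpace Y]
    (p q : WithLp 2 (X × Y)) :
    dist p.fst q.fst ^ 2 + dist p.snd q.snd ^ 2 = dist p q ^ 2 := by
  rw [WithLp.prod_dist_eq_add (by norm_num)]
  simp only [ENNReal.toReal_ofNat, Real.rpow_ofNat, ← Real.sqrt_eq_rpow]
  rw [Real.sq_sqrt (by positivity)]

/-- The components of a geodesic of an `ℓ²` product are geodesics. -/
theorem IsGeodesic.fst_snd {X Y : Type*} [MetricSpace X] [MetricSpace Y]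
    {γ : ℝ → WithLp 2 (X × Y)} (hγ : IsGeodesic γ) :
    IsGeodesic (fun t => (γ t).fst) ∧ IsGeodesic (fun t => (γ t).snd) := by
  have hd : ∀ s t : ℝ, 0 ≤ s → s ≤ t → t ≤ 1 →
      dist (γ s).fst (γ t).fst ^ 2 + dist (γ s).snd (γ t).snd ^ 2
        = (dist (γ 0) (γ 1) * (t - s)) ^ 2 := by
    intro s t h0 h1 h2
    have := hγ.dist_eq ⟨h0, h1.trans h2⟩ ⟨h0.trans h1, h2⟩
    rw [abs_sub_comm, abs_of_nonneg (sub_nonneg.2 h1)] at this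
    rw [← this, prod_dist_sq_eq_of_L2]
  have hd' : ∀ s t : ℝ, 0 ≤ s → s ≤ t → t ≤ 1 →
      dist (γ s).snd (γ t).snd ^ 2 + dist (γ s).fst (γ t).fst ^ 2
        = (dist (γ 0) (γ 1) * (t - s)) ^ 2 := by
    intro s t h0 h1 h2
    rw [add_comm, hd s t h0 h1 h2]
  constructor
  · exact isGeodesic_of_sorted dist_nonneg fun s t h0 h1 h2 =>
      affine_of_sq_add_sq (f := fun s t => dist (γ s).fst (γ t).fst)
        (g := fun s t => dist (γ s).snd (γ t).snd) (fun _ _ => dist_nonneg) (fun _ _ => dist_nonneg)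
        (fun _ _ _ => dist_triangle _ _ _) (fun _ _ _ => dist_triangle _ _ _) hd h0 h1 h2
  · exact isGeodesic_of_sorted dist_nonneg fun s t h0 h1 h2 =>
      affine_of_sq_add_sq (f := fun s t => dist (γ s).snd (γ t).snd)
        (g := fun s t => dist (γ s).fst (γ t).fst) (fun _ _ => dist_nonneg) (fun _ _ => dist_nonneg)
        (fun _ _ _ => dist_triangle _ _ _) (fun _ _ _ => dist_triangle _ _ _) hd' h0 h1 h2

/-! ### Spherical triangles -/

theorem cos_angle_modelSphere (x y : ModelSphere) :
    Real.cos (InnerProductGeometry.angle (x : EuclideanSpace ℝ (Fin 3)) y)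
      = inner ℝ (x : EuclideanSpace ℝ (Fin 3)) y := by
  rw [InnerProductGeometry.cos_angle]
  simp

theorem angle_modelSphere_eq {x y : ModelSphere} {A : ℝ} (h0 : 0 ≤ A) (h1 : A ≤ Real.pi)
    (h : inner ℝ (x : EuclideanSpace ℝ (Fin 3)) (y : EuclideanSpace ℝ (Fin 3)) = Real.cos A) :
    InnerProductGeometry.angle (x : EuclideanSpace ℝ (Fin 3)) y = A := by
  refine Real.injOn_cos ⟨InnerProductGeometry.angle_nonneg _ _,
    InnerProductGeometry.angle_le_pi _ _⟩ ⟨h0, h1⟩ ?_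
  rw [cos_angle_modelSphere, h]

/-- Two points of the sphere that are not antipodal are joined by a geodesic `σ`; the last clause
says that `sin A • σ t = sin ((1 - t) A) • u + sin (t A) • v`, tested against points `w`. -/
theorem exists_modelSphere_geodesic {κ : ℝ} (u v : ModelSphere) {A : ℝ} (hA0 : 0 ≤ A)
    (hA : A < Real.pi)
    (huv : InnerProductGeometry.angle (u : EuclideanSpace ℝ (Fin 3)) v = A) :
    ∃ σ : ℝ → ModelSphere, σ 0 = u ∧ σ 1 = v ∧ IsGeodesicFor (modelDist κ) σ ∧
      ∀ (w : ModelSphere) (t : ℝ),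
        Real.sin A * inner ℝ (w : EuclideanSpace ℝ (Fin 3)) (σ t : EuclideanSpace ℝ (Fin 3))
          = Real.sin ((1 - t) * A) * inner ℝ (w : EuclideanSpace ℝ (Fin 3)) u
            + Real.sin (t * A) * inner ℝ (w : EuclideanSpace ℝ (Fin 3)) v := by
  have hu : ‖(u : EuclideanSpace ℝ (Fin 3))‖ = 1 := norm_eq_of_mem_sphere u
  have hv : ‖(v : EuclideanSpace ℝ (Fin 3))‖ = 1 := norm_eq_of_mem_sphere v
  have hin : inner ℝ (u : EuclideanSpace ℝ (Fin 3)) v = Real.cos A := by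
    rw [← cos_angle_modelSphere, huv]
  rcases hA0.eq_or_lt with rfl | hA0
  · have : u = v := by
      rw [Real.cos_zero] at hin
      exact Subtype.ext ((inner_eq_one_iff_of_norm_eq_one hu hv).1 hin)
    subst this
    refine ⟨fun _ => u, rfl, rfl, ⟨0, le_rfl, fun s _ t _ => ?_⟩, by simp⟩
    simp [modelDist, huv]
  have hs : 0 < Real.sin A := Real.sin_pos_of_pos_of_lt_pi hA0 hA
  obtain ⟨e, he⟩ : ∃ e : EuclideanSpace ℝ (Fin 3),
      (v : EuclideanSpace ℝ (Fin 3)) = Real.cos A • (u : EuclideanSpace ℝ (Fin 3))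
        + Real.sin A • e :=
    ⟨(Real.sin A)⁻¹ •
        ((v : EuclideanSpace ℝ (Fin 3)) - Real.cos A • (u : EuclideanSpace ℝ (Fin 3))),
      by rw [smul_smul, mul_inv_cancel₀ hs.ne']; simp⟩
  have huu : inner ℝ (u : EuclideanSpace ℝ (Fin 3)) (u : EuclideanSpace ℝ (Fin 3)) = 1 := by
    rw [real_inner_self_eq_norm_sq, hu]; norm_num
  have hvv : inner ℝ (v : EuclideanSpace ℝ (Fin 3)) (v : EuclideanSpace ℝ (Fin 3)) = 1 := by
    rw [real_inner_self_eq_norm_sq, hv]; norm_num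
  have hue : inner ℝ (u : EuclideanSpace ℝ (Fin 3)) e = 0 := by
    rw [he, inner_add_right, inner_smul_right, inner_smul_right, huu] at hin
    have : Real.sin A * inner ℝ (u : EuclideanSpace ℝ (Fin 3)) e = 0 := by linarith
    exact (mul_eq_zero.1 this).resolve_left hs.ne'
  have heu : inner ℝ e (u : EuclideanSpace ℝ (Fin 3)) = 0 := by rw [real_inner_comm, hue]
  have hee : inner ℝ e e = 1 := by
    rw [he] at hvv
    simp only [inner_add_left, inner_add_right, real_inner_smul_left, real_inner_smul_right, huu,
      hue, heu] at hvv
    have : Real.sin A ^ 2 * (inner ℝ e e - 1) = 0 := by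
      linear_combination hvv - Real.sin_sq_add_cos_sq A
    have := (mul_eq_zero.1 this).resolve_left (by positivity)
    linarith
  have hinner : ∀ s t : ℝ, inner ℝ (Real.cos s • (u : EuclideanSpace ℝ (Fin 3)) + Real.sin s • e)
      (Real.cos t • (u : EuclideanSpace ℝ (Fin 3)) + Real.sin t • e) = Real.cos (s - t) := by
    intro s t
    simp only [inner_add_left, inner_add_right, real_inner_smul_left, real_inner_smul_right, huu,
      hue, heu, hee, Real.cos_sub]
    ring
  have hmem : ∀ t : ℝ, Real.cos t • (u : EuclideanSpace ℝ (Fin 3)) + Real.sin t • e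
      ∈ Metric.sphere (0 : EuclideanSpace ℝ (Fin 3)) 1 := by
    intro t
    rw [mem_sphere_zero_iff_norm, ← sq_eq_sq₀ (norm_nonneg _) zero_le_one,
      ← real_inner_self_eq_norm_sq, hinner]
    simp
  refine ⟨fun t => ⟨_, hmem (t * A)⟩, ?_, ?_, ⟨A / √κ, by positivity, fun s hs t ht => ?_⟩, ?_⟩
  · apply Subtype.ext; simp
  · apply Subtype.ext; simp [he]
  · have habs : |s - t| ≤ 1 := by
      rw [abs_le]; constructor <;> linarith [hs.1, hs.2, ht.1, ht.2]
    rw [modelDist, angle_modelSphere_eq (A := A * |s - t|) (by positivity) (by nlinarith)]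
    · ring
    · dsimp only
      rw [hinner, ← Real.cos_abs, ← sub_mul, abs_mul, abs_of_pos hA0, mul_comm]
  · intro w t
    dsimp only
    rw [he, sub_mul, one_mul, Real.sin_sub]
    simp only [inner_add_right, real_inner_smul_right]
    ring

/-- Spherical triangles with prescribed sides exist. -/
theorem exists_modelSphere_triangle {A B C : ℝ} (hA : 0 ≤ A) (hB : 0 ≤ B) (hC : 0 ≤ C)
    (hA' : A < Real.pi / 2) (hB' : B < Real.pi / 2) (hC' : C < Real.pi / 2)
    (hABC : A ≤ B + C) (hBCA : B ≤ C + A) (hCAB : C ≤ A + B) :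
    ∃ u v w : ModelSphere, InnerProductGeometry.angle (u : EuclideanSpace ℝ (Fin 3)) v = A ∧
      InnerProductGeometry.angle (v : EuclideanSpace ℝ (Fin 3)) w = B ∧
      InnerProductGeometry.angle (w : EuclideanSpace ℝ (Fin 3)) u = C := by
  -- the angle at `u`; the quotient has the junk value `0` when `u = v` or `u = w`
  set φ : ℝ := Real.arccos ((Real.cos B - Real.cos A * Real.cos C) / (Real.sin A * Real.sin C))
    with hφ
  have hsA : 0 ≤ Real.sin A := Real.sin_nonneg_of_nonneg_of_le_pi hA (by linarith)
  have hsC : 0 ≤ Real.sin C := Real.sin_nonneg_of_nonneg_of_le_pi hC (by linarith)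
  have h1 : Real.cos (A + C) ≤ Real.cos B :=
    Real.cos_le_cos_of_nonneg_of_le_pi hB (by linarith) (by linarith)
  have h2 : Real.cos B ≤ Real.cos (A - C) := by
    rw [← Real.cos_abs (A - C)]
    exact Real.cos_le_cos_of_nonneg_of_le_pi (abs_nonneg _) (by linarith)
      (abs_le.2 ⟨by linarith, by linarith⟩)
  rw [Real.cos_add] at h1
  rw [Real.cos_sub] at h2
  have hcos : Real.sin A * Real.sin C * Real.cos φ
      = Real.cos B - Real.cos A * Real.cos C := by
    rcases (mul_nonneg hsA hsC).eq_or_lt with h0 | h0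
    · rw [← h0]; linarith
    · rw [hφ, Real.cos_arccos, mul_div_cancel₀ _ h0.ne']
      · rw [le_div_iff₀ h0]; linarith
      · rw [div_le_iff₀ h0]; linarith
  have hmem : ∀ a b c : ℝ, a ^ 2 + b ^ 2 + c ^ 2 = 1 →
      !₂[a, b, c] ∈ Metric.sphere (0 : EuclideanSpace ℝ (Fin 3)) 1 := by
    intro a b c h
    rw [mem_sphere_zero_iff_norm, EuclideanSpace.norm_eq]
    simp [Fin.sum_univ_three, h]
  refine ⟨⟨!₂[1, 0, 0], hmem _ _ _ (by norm_num)⟩,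
    ⟨!₂[Real.cos A, Real.sin A, 0], hmem _ _ _ (by simp)⟩,
    ⟨!₂[Real.cos C, Real.sin C * Real.cos φ, Real.sin C * Real.sin φ], hmem _ _ _ ?_⟩,
    angle_modelSphere_eq hA (by linarith) ?_, angle_modelSphere_eq hB (by linarith) ?_,
    angle_modelSphere_eq hC (by linarith) ?_⟩
  · linear_combination Real.sin C ^ 2 * Real.sin_sq_add_cos_sq φ + Real.sin_sq_add_cos_sq C
  · simp [PiLp.inner_apply, Fin.sum_univ_three]
  · simp only [PiLp.inner_apply, Fin.sum_univ_three]
    simp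
    linarith
  · simp [PiLp.inner_apply, Fin.sum_univ_three]

/-! ### The cosine form of the comparison inequality -/

theorem cosK_pos_of_lt {κ a : ℝ} (h0 : 0 ≤ √κ * a) (h : √κ * a < Real.pi / 2) :
    0 < cosK κ a := Real.cos_pos_of_mem_Ioo ⟨by linarith [Real.pi_pos], h⟩

/-- Comparison of the distance from `w` to a point of a geodesic with the spherical one. -/
theorem IsCAT.cosK_dist_geodesic {X : Type*} [MetricSpace X] {κ : ℝ} (hκ : 0 < κ)
    (hX : IsCAT κ X) {γ : ℝ → X} (hγ : IsGeodesic γ) {w : X}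
    (h01 : √κ * dist (γ 0) (γ 1) < Real.pi / 2) (h0 : √κ * dist w (γ 0) < Real.pi / 2)
    (h1 : √κ * dist w (γ 1) < Real.pi / 2) {t : ℝ} (ht : t ∈ Set.Icc (0 : ℝ) 1) :
    √κ * dist w (γ t) ≤ Real.pi ∧
      Real.sin ((1 - t) * (√κ * dist (γ 0) (γ 1))) * cosK κ (dist w (γ 0))
        + Real.sin (t * (√κ * dist (γ 0) (γ 1))) * cosK κ (dist w (γ 1))
        ≤ Real.sin (√κ * dist (γ 0) (γ 1)) * cosK κ (dist w (γ t)) := by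
  have hk : 0 < √κ := Real.sqrt_pos.2 hκ
  have hpi := Real.pi_pos
  have hmd : ∀ d : ℝ, √κ * d < Real.pi / 2 → d < modelDiam κ := by
    intro d hd
    rw [modelDiam, lt_div_iff₀ hk]; linarith
  obtain ⟨α, hα, hα0, hα1⟩ := hX.exists_geodesic w (γ 0) (hmd _ h0)
  obtain ⟨β, hβ, hβ0, hβ1⟩ := hX.exists_geodesic (γ 1) w (hmd _ (by rwa [dist_comm]))
  have tri : ∀ a b c : X, √κ * dist a b ≤ √κ * dist a c + √κ * dist c b := by
    intro a b c
    rw [← mul_add]; exact mul_le_mul_of_nonneg_left (dist_triangle _ _ _) hk.le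
  obtain ⟨u, p, q, hup, hpq, hqu⟩ := exists_modelSphere_triangle
    (A := √κ * dist w (γ 0)) (B := √κ * dist (γ 0) (γ 1)) (C := √κ * dist w (γ 1))
    (by positivity) (by positivity) (by positivity) h0 h01 h1
    (by have := tri w (γ 0) (γ 1); rw [dist_comm (γ 1)] at this; linarith)
    (by have := tri (γ 0) (γ 1) w; rw [dist_comm (γ 0) w] at this; linarith)
    (tri w (γ 1) (γ 0))
  obtain ⟨σ, hσ0, hσ1, hσ, -⟩ :=
    exists_modelSphere_geodesic (κ := κ) u p (by positivity) (by linarith) hup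
  obtain ⟨τ, hτ0, hτ1, hτ, hτin⟩ :=
    exists_modelSphere_geodesic (κ := κ) p q (by positivity) (by linarith) hpq
  obtain ⟨ρ, hρ0, hρ1, hρ, -⟩ :=
    exists_modelSphere_geodesic (κ := κ) q u (by positivity) (by linarith) hqu
  let T : GeodesicTriangle (fun x y : X => dist x y) :=
    { vertex := ![w, γ 0, γ 1]
      side := ![α, γ, β]
      isGeodesic_side := by
        intro i
        fin_cases i
        · exact hα
        · exact hγ
        · exact hβ
      side_zero := by
        intro i
        fin_cases i
        · exact hα0
        · rfl
        · exact hβ0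
      side_one := by
        intro i
        fin_cases i
        · exact hα1
        · rfl
        · exact hβ1 }
  let T' : GeodesicTriangle (modelDist κ) :=
    { vertex := ![u, p, q]
      side := ![σ, τ, ρ]
      isGeodesic_side := by
        intro i
        fin_cases i
        · exact hσ
        · exact hτ
        · exact hρ
      side_zero := by
        intro i
        fin_cases i
        · exact hσ0
        · exact hτ0
        · exact hρ0
      side_one := by
        intro i
        fin_cases i
        · exact hσ1
        · exact hτ1
        · exact hρ1 }
  have hper : T.perimeter < 2 * modelDiam κ := by
    have : T.perimeter = dist w (γ 0) + dist (γ 0) (γ 1) + dist (γ 1) w := by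
      rw [GeodesicTriangle.perimeter, Fin.sum_univ_three]; rfl
    rw [this, modelDiam, mul_div_assoc', lt_div_iff₀ hk, dist_comm (γ 1)]
    linarith
  have hside : ∀ i, modelDist κ (T'.vertex i) (T'.vertex (i + 1))
      = dist (T.vertex i) (T.vertex (i + 1)) := by
    intro i
    fin_cases i
    · change InnerProductGeometry.angle (u : EuclideanSpace ℝ (Fin 3)) p / √κ = dist w (γ 0)
      rw [hup, mul_div_cancel_left₀ _ hk.ne']
    · change InnerProductGeometry.angle (p : EuclideanSpace ℝ (Fin 3)) q / √κ = dist (γ 0) (γ 1)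
      rw [hpq, mul_div_cancel_left₀ _ hk.ne']
    · change InnerProductGeometry.angle (q : EuclideanSpace ℝ (Fin 3)) u / √κ = dist (γ 1) w
      rw [hqu, mul_div_cancel_left₀ _ hk.ne', dist_comm]
  have hcmp : dist (α 0) (γ t) ≤ modelDist κ (σ 0) (τ t) :=
    hX.comparison T T' hper hside 0 1 0 (by simp) t ht
  rw [hα0, hσ0, modelDist, le_div_iff₀ hk, mul_comm] at hcmp
  have hle := InnerProductGeometry.angle_le_pi (u : EuclideanSpace ℝ (Fin 3)) (τ t)
  refine ⟨hcmp.trans hle, ?_⟩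
  have hcos := Real.cos_le_cos_of_nonneg_of_le_pi (by positivity) hle hcmp
  rw [cos_angle_modelSphere] at hcos
  have hs : 0 ≤ Real.sin (√κ * dist (γ 0) (γ 1)) :=
    Real.sin_nonneg_of_nonneg_of_le_pi (by positivity) (by linarith)
  have h3 := mul_le_mul_of_nonneg_left hcos hs
  rw [hτin, ← cos_angle_modelSphere u p, hup, ← cos_angle_modelSphere u q,
    InnerProductGeometry.angle_comm, hqu] at h3
  exact h3

theorem IsCAT.cosK_dist_half {X : Type*} [MetricSpace X] {κ : ℝ} (hκ : 0 < κ)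
    (hX : IsCAT κ X) {γ : ℝ → X} (hγ : IsGeodesic γ) {w : X}
    (h01 : √κ * dist (γ 0) (γ 1) < Real.pi / 2) (h0 : √κ * dist w (γ 0) < Real.pi / 2)
    (h1 : √κ * dist w (γ 1) < Real.pi / 2) :
    cosK κ (dist w (γ 0)) + cosK κ (dist w (γ 1))
      ≤ 2 * Real.cos (√κ * dist (γ 0) (γ 1) / 2) * cosK κ (dist w (γ (1 / 2))) := by
  have hhalf : (1 / 2 : ℝ) ∈ Set.Icc (0 : ℝ) 1 := by norm_num
  have hA0 : 0 ≤ √κ * dist (γ 0) (γ 1) := by positivity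
  rcases hA0.eq_or_lt with hA | hA
  · have hd : dist (γ 0) (γ 1) = 0 := by
      simpa [(Real.sqrt_pos.2 hκ).ne'] using hA.symm
    have hz : γ 0 = γ (1 / 2) := by
      have := hγ.dist_eq (s := 0) (t := 1 / 2) (by simp) hhalf
      rw [hd, zero_mul] at this
      exact dist_eq_zero.1 this
    rw [← dist_eq_zero.1 hd, ← hz]
    simp; linarith
  · have h := (hX.cosK_dist_geodesic hκ hγ h01 h0 h1 hhalf).2
    set A := √κ * dist (γ 0) (γ 1)
    rw [show (1 - 1 / 2 : ℝ) * A = A / 2 by ring, show (1 / 2 : ℝ) * A = A / 2 by ring,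
      show Real.sin A = 2 * Real.sin (A / 2) * Real.cos (A / 2) by
        rw [← Real.sin_two_mul]; ring_nf] at h
    have hs : 0 < Real.sin (A / 2) := Real.sin_pos_of_pos_of_lt_pi (by linarith) (by linarith)
    refine le_of_mul_le_mul_left ?_ hs
    linarith

/-- For positive weights `a`, `b` the segment from `p` to `q` contains a point `z` playing the role
of the normalization of `a • p + b • q` on the sphere. -/
theorem IsCAT.exists_weighted_point {X : Type*} [MetricSpace X] {κ : ℝ} (hκ : 0 < κ)
    (hX : IsCAT κ X) {p q : X} (hpq : √κ * dist p q < Real.pi / 2) {a b : ℝ} (ha : 0 < a)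
    (hb : 0 < b) :
    ∃ z : X, ∀ w : X, √κ * dist w p < Real.pi / 2 → √κ * dist w q < Real.pi / 2 →
      √κ * dist w z ≤ Real.pi ∧
      a * cosK κ (dist w p) + b * cosK κ (dist w q)
        ≤ √(a ^ 2 + b ^ 2 + 2 * a * b * cosK κ (dist p q)) * cosK κ (dist w z) := by
  have hk : 0 < √κ := Real.sqrt_pos.2 hκ
  have hpi := Real.pi_pos
  obtain ⟨γ, hγ, rfl, rfl⟩ := hX.exists_geodesic p q
    (by rw [modelDiam, lt_div_iff₀ hk]; linarith)
  have hA0 : 0 ≤ √κ * dist (γ 0) (γ 1) := by positivity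
  rcases hA0.eq_or_lt with hA | hA
  · have hd : dist (γ 0) (γ 1) = 0 := by simpa [hk.ne'] using hA.symm
    refine ⟨γ 0, fun w h0 h1 => ⟨by linarith, ?_⟩⟩
    rw [hd, ← dist_eq_zero.1 hd]
    have : a ^ 2 + b ^ 2 + 2 * a * b * cosK κ 0 = (a + b) ^ 2 := by simp [cosK]; ring
    rw [this, Real.sqrt_sq (by positivity)]
    linarith
  set A := √κ * dist (γ 0) (γ 1) with hAdef
  have hcA : cosK κ (dist (γ 0) (γ 1)) = Real.cos A := rfl
  rw [hcA]
  have hc : 0 < Real.cos A := Real.cos_pos_of_mem_Ioo ⟨by linarith, hpq⟩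
  have hs : 0 < Real.sin A := Real.sin_pos_of_pos_of_lt_pi hA (by linarith)
  set N := √(a ^ 2 + b ^ 2 + 2 * a * b * Real.cos A) with hN
  have hN0 : 0 < N := Real.sqrt_pos.2 (by positivity)
  have hN2 : N ^ 2 = (a + b * Real.cos A) ^ 2 + (b * Real.sin A) ^ 2 := by
    rw [hN, Real.sq_sqrt (by positivity)]
    linear_combination (-b ^ 2) * Real.sin_sq_add_cos_sq A
  -- `θ` is the angle from `p` to the direction of `a • p + b • q`
  set θ := Real.arccos ((a + b * Real.cos A) / N) with hθ
  have hle : (a + b * Real.cos A) / N ≤ 1 := by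
    rw [div_le_one hN0]
    exact abs_le_of_sq_le_sq' (by nlinarith [sq_nonneg (b * Real.sin A)]) hN0.le |>.2
  have hcθ : N * Real.cos θ = a + b * Real.cos A := by
    rw [hθ, Real.cos_arccos (by linarith [show 0 < (a + b * Real.cos A) / N by positivity]) hle,
      mul_div_cancel₀ _ hN0.ne']
  have hθ0 : 0 ≤ θ := Real.arccos_nonneg _
  have hθpi : θ ≤ Real.pi := Real.arccos_le_pi _
  have hsθ : N * Real.sin θ = b * Real.sin A := by
    have h1 : 0 ≤ N * Real.sin θ :=
      mul_nonneg hN0.le (Real.sin_nonneg_of_nonneg_of_le_pi hθ0 hθpi)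
    refine (pow_left_inj₀ h1 (by positivity) two_ne_zero).1 ?_
    have := Real.sin_sq_add_cos_sq θ
    calc (N * Real.sin θ) ^ 2 = N ^ 2 - (N * Real.cos θ) ^ 2 := by
          linear_combination N ^ 2 * this
      _ = _ := by rw [hcθ, hN2]; ring
  have hsA : N * Real.sin (A - θ) = a * Real.sin A := by
    rw [Real.sin_sub]
    linear_combination Real.sin A * hcθ - Real.cos A * hsθ
  have hθA : θ ≤ A := by
    by_contra! hlt
    have : Real.sin (A - θ) < 0 := Real.sin_neg_of_neg_of_neg_pi_lt (by linarith) (by linarith)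
    have h1 : 0 < a * Real.sin A := by positivity
    nlinarith
  have ht : θ / A ∈ Set.Icc (0 : ℝ) 1 := ⟨by positivity, (div_le_one hA).2 hθA⟩
  refine ⟨γ (θ / A), fun w h0 h1 => ?_⟩
  obtain ⟨h2, h3⟩ := hX.cosK_dist_geodesic hκ hγ hpq h0 h1 ht
  refine ⟨h2, ?_⟩
  rw [← hAdef, show (1 - θ / A) * A = A - θ by field_simp, div_mul_cancel₀ _ hA.ne'] at h3
  refine le_of_mul_le_mul_left ?_ hs
  have h4 := mul_le_mul_of_nonneg_left h3 hN0.le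
  linear_combination h4 - cosK κ (dist w (γ 0)) * hsA - cosK κ (dist w (γ 1)) * hsθ

/-! ### Quadrilaterals -/

/-- Half the chord subtending a spherical arc that has the length of the segment from `x` to `y`. -/
noncomputable def halfChord {X : Type*} [MetricSpace X] (κ : ℝ) (x y : X) : ℝ :=
  Real.sin (√κ * dist x y / 2)

theorem cosK_dist_eq {X : Type*} [MetricSpace X] (κ : ℝ) (x y : X) :
    cosK κ (dist x y) = 1 - 2 * halfChord κ x y ^ 2 := by
  rw [cosK, halfChord, show √κ * dist x y = 2 * (√κ * dist x y / 2) by ring, Real.cos_two_mul,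
    Real.cos_sq']
  ring_nf

theorem halfChord_nonneg {X : Type*} [MetricSpace X] {κ : ℝ} {x y : X}
    (h : √κ * dist x y < Real.pi / 2) : 0 ≤ halfChord κ x y :=
  Real.sin_nonneg_of_nonneg_of_le_pi (by positivity) (by linarith [Real.pi_pos])

theorem eq_of_halfChord_eq_zero {X : Type*} [MetricSpace X] {κ : ℝ} (hκ : 0 < κ) {x y : X}
    (h : √κ * dist x y < Real.pi / 2) (h0 : halfChord κ x y = 0) : x = y := by
  have hk : 0 < √κ := Real.sqrt_pos.2 hκ
  by_contra hne
  have : 0 < √κ * dist x y := mul_pos hk (dist_pos.2 hne)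
  have := Real.sin_pos_of_pos_of_lt_pi (x := √κ * dist x y / 2) (by linarith)
    (by linarith [Real.pi_pos])
  exact this.ne' h0

/-- Lower bound for the cosine of a sum of two angles: the distance from the point `N` to
`a * exp (i θ) + b * exp (-i φ)` is nonnegative. -/
theorem two_mul_cos_add_ge (a b N θ φ : ℝ) :
    2 * N * (a * Real.cos θ + b * Real.cos φ) - a ^ 2 - b ^ 2 - N ^ 2
      ≤ 2 * a * b * Real.cos (θ + φ) := by
  rw [Real.cos_add]
  have h := add_nonneg (sq_nonneg (a * Real.cos θ + b * Real.cos φ - N))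
    (sq_nonneg (a * Real.sin θ - b * Real.sin φ))
  linear_combination h + a ^ 2 * Real.sin_sq_add_cos_sq θ + b ^ 2 * Real.sin_sq_add_cos_sq φ

/-- Quadrilateral inequality: in terms of chords,
`|x₀y₁|² + |x₁y₀|² ≤ |x₀x₁|² + |y₀y₁|² + 2 |x₀y₀| |x₁y₁|`. It follows from the comparison for the
point `z` of the diagonal `x₀y₁` with weights `|x₁y₁|` at `x₀` and `|x₀y₀|` at `y₁`, since
`d (x₁, y₀) ≤ d (x₁, z) + d (z, y₀)`. -/
theorem IsCAT.quadrilateral {X : Type*} [MetricSpace X] {κ : ℝ} (hκ : 0 < κ)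
    (hX : IsCAT κ X) {x₀ x₁ y₀ y₁ : X}
    (hxx : √κ * dist x₀ x₁ < Real.pi / 2) (hyy : √κ * dist y₀ y₁ < Real.pi / 2)
    (h00 : √κ * dist x₀ y₀ < Real.pi / 2) (h11 : √κ * dist x₁ y₁ < Real.pi / 2)
    (h01 : √κ * dist x₀ y₁ < Real.pi / 2) :
    cosK κ (dist x₀ x₁) + cosK κ (dist y₀ y₁) - 4 * halfChord κ x₀ y₀ * halfChord κ x₁ y₁
      ≤ cosK κ (dist x₀ y₁) + cosK κ (dist x₁ y₀) := by
  have hk : 0 < √κ := Real.sqrt_pos.2 hκ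
  have hpi := Real.pi_pos
  rcases (halfChord_nonneg h00).eq_or_lt with hs0 | hs0
  · rw [← hs0, eq_of_halfChord_eq_zero hκ h00 hs0.symm, dist_comm x₁ y₀]
    linarith
  rcases (halfChord_nonneg h11).eq_or_lt with hs1 | hs1
  · rw [← hs1, eq_of_halfChord_eq_zero hκ h11 hs1.symm, dist_comm y₁ y₀]
    linarith
  have e00 := cosK_dist_eq κ x₀ y₀
  have e11 := cosK_dist_eq κ x₁ y₁
  set s₀ := halfChord κ x₀ y₀
  set s₁ := halfChord κ x₁ y₁
  obtain ⟨z, hz⟩ := hX.exists_weighted_point hκ h01 hs1 hs0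
  obtain ⟨hxπ, hx⟩ := hz x₁ (by rwa [dist_comm]) h11
  obtain ⟨hyπ, hy⟩ := hz y₀ (by rwa [dist_comm]) hyy
  have pos01 := cosK_pos_of_lt (by positivity) h01
  have posxx := cosK_pos_of_lt (by positivity) hxx
  have posyy := cosK_pos_of_lt (by positivity) hyy
  have pos00 := cosK_pos_of_lt (by positivity) h00
  have pos11 := cosK_pos_of_lt (by positivity) h11
  rw [dist_comm x₁ x₀] at hx
  rw [dist_comm y₀ x₀] at hy
  have hN2 := Real.sq_sqrt
    (show 0 ≤ s₁ ^ 2 + s₀ ^ 2 + 2 * s₁ * s₀ * cosK κ (dist x₀ y₁) by positivity)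
  set N := √(s₁ ^ 2 + s₀ ^ 2 + 2 * s₁ * s₀ * cosK κ (dist x₀ y₁))
  have hN0 : 0 ≤ N := Real.sqrt_nonneg _
  -- both angles at `z` are acute, so that the cosine is monotone on the relevant range
  have acute : ∀ w : X, √κ * dist w z ≤ Real.pi → 0 < N * cosK κ (dist w z) →
      √κ * dist w z ≤ Real.pi / 2 := by
    intro w hw hpos
    by_contra! hlt
    have := Real.cos_nonpos_of_pi_div_two_le_of_le hlt.le (by linarith)
    have : cosK κ (dist w z) ≤ 0 := this
    nlinarith
  have hxa := acute x₁ hxπ (lt_of_lt_of_le (by positivity) hx)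
  have hya := acute y₀ hyπ (lt_of_lt_of_le (by positivity) hy)
  have htri : √κ * dist x₁ y₀ ≤ √κ * dist x₁ z + √κ * dist y₀ z := by
    rw [← mul_add]
    exact mul_le_mul_of_nonneg_left (dist_triangle_right _ _ _) hk.le
  have hcos : Real.cos (√κ * dist x₁ z + √κ * dist y₀ z) ≤ cosK κ (dist x₁ y₀) :=
    Real.cos_le_cos_of_nonneg_of_le_pi (by positivity) (by linarith) htri
  have hlow := two_mul_cos_add_ge s₀ s₁ N (√κ * dist x₁ z) (√κ * dist y₀ z)
  change 2 * N * (s₀ * cosK κ (dist x₁ z) + s₁ * cosK κ (dist y₀ z)) - s₀ ^ 2 - s₁ ^ 2 - N ^ 2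
    ≤ _ at hlow
  have hss : 0 < 2 * s₀ * s₁ := by positivity
  refine le_of_mul_le_mul_left ?_ hss
  have k1 := mul_le_mul_of_nonneg_left hx hs0.le
  have k2 := mul_le_mul_of_nonneg_left hy hs1.le
  have k3 := mul_le_mul_of_nonneg_left hcos hss.le
  rw [e11] at k1
  rw [e00] at k2
  nlinarith

/-- Along two geodesics, the half chord between the midpoints is bounded by the average of the half
chords between the endpoints, up to the factor it has on the sphere. -/
theorem IsCAT.halfChord_midpoint_sq_le {X : Type*} [MetricSpace X] {κ : ℝ} (hκ : 0 < κ)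
    (hX : IsCAT κ X) {α β : ℝ → X} (hα : IsGeodesic α) (hβ : IsGeodesic β)
    (h : ∀ x ∈ ({α 0, α (1 / 2), α 1, β 0, β (1 / 2), β 1} : Set X),
      ∀ y ∈ ({α 0, α (1 / 2), α 1, β 0, β (1 / 2), β 1} : Set X), √κ * dist x y < Real.pi / 2) :
    4 * (Real.cos (√κ * dist (α 0) (α 1) / 2) * Real.cos (√κ * dist (β 0) (β 1) / 2))
        * halfChord κ (α (1 / 2)) (β (1 / 2)) ^ 2
      ≤ (halfChord κ (α 0) (β 0) + halfChord κ (α 1) (β 1)) ^ 2 := by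
  have hpi := Real.pi_pos
  have hquad := hX.quadrilateral hκ (x₀ := α 0) (x₁ := α 1) (y₀ := β 0) (y₁ := β 1)
    (h _ (by simp) _ (by simp)) (h _ (by simp) _ (by simp)) (h _ (by simp) _ (by simp))
    (h _ (by simp) _ (by simp)) (h _ (by simp) _ (by simp))
  have hm := hX.cosK_dist_half hκ hβ (w := α (1 / 2)) (h _ (by simp) _ (by simp))
    (h _ (by simp) _ (by simp)) (h _ (by simp) _ (by simp))
  have h0 := hX.cosK_dist_half hκ hα (w := β 0) (h _ (by simp) _ (by simp))
    (h _ (by simp) _ (by simp)) (h _ (by simp) _ (by simp))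
  have h1 := hX.cosK_dist_half hκ hα (w := β 1) (h _ (by simp) _ (by simp))
    (h _ (by simp) _ (by simp)) (h _ (by simp) _ (by simp))
  simp only [dist_comm (β 0) (α _), dist_comm (β 1) (α _)] at h0 h1
  have half : ∀ x y : X, cosK κ (dist x y) = 2 * Real.cos (√κ * dist x y / 2) ^ 2 - 1 := by
    intro x y
    rw [← Real.cos_two_mul, cosK]; ring_nf
  rw [half (α 0) (α 1), half (β 0) (β 1)] at hquad
  have hposa : 0 < Real.cos (√κ * dist (α 0) (α 1) / 2) := by
    have := h (α 0) (by simp) (α 1) (by simp)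
    have h0 : 0 ≤ √κ * dist (α 0) (α 1) := by positivity
    exact Real.cos_pos_of_mem_Ioo ⟨by linarith, by linarith⟩
  set a := Real.cos (√κ * dist (α 0) (α 1) / 2)
  set b := Real.cos (√κ * dist (β 0) (β 1) / 2)
  have k := mul_le_mul_of_nonneg_left hm (by positivity : 0 ≤ 2 * a)
  have e00 := cosK_dist_eq κ (α 0) (β 0)
  have e11 := cosK_dist_eq κ (α 1) (β 1)
  have emm := cosK_dist_eq κ (α (1 / 2)) (β (1 / 2))
  rw [emm] at k
  nlinarith [sq_nonneg (a - b)]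

/-! ### The denominator -/

theorem two_mul_sqrt_mul_sqrt_le {p₀ p₁ q₀ q₁ : ℝ} (hp₀ : 0 ≤ p₀) (hp₁ : 0 ≤ p₁) (hq₀ : 0 ≤ q₀)
    (hq₁ : 0 ≤ q₁) (h₀ : 1 / 2 ≤ p₀ * q₀) (h₁ : 1 / 2 ≤ p₁ * q₁) :
    2 * (√(p₀ * q₀ - 1 / 2) * √(p₁ * q₁ - 1 / 2)) ≤ p₀ * q₁ + p₁ * q₀ - 1 := by
  have hPQ : 1 ≤ p₀ * q₁ + p₁ * q₀ := by
    have h : 1 / 4 ≤ (p₀ * q₁) * (p₁ * q₀) := by nlinarith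
    have := mul_nonneg hp₀ hq₁
    have := mul_nonneg hp₁ hq₀
    nlinarith [sq_nonneg (p₀ * q₁ - p₁ * q₀)]
  refine abs_le_of_sq_le_sq' ?_ (by linarith) |>.2
  rw [mul_pow, mul_pow, Real.sq_sqrt (by linarith), Real.sq_sqrt (by linarith)]
  suffices -(2 * ((p₀ - p₁) * (q₀ - q₁))) ≤ (p₀ * q₁ - p₁ * q₀) ^ 2 by nlinarith
  rcases le_total 0 ((p₀ - p₁) * (q₀ - q₁)) with h | h
  · nlinarith [sq_nonneg (p₀ * q₁ - p₁ * q₀)]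
  · -- the two terms of `p₀ q₁ - p₁ q₀ = (p₀ - p₁) q₀ - p₀ (q₀ - q₁)` have the same sign, so its
    -- square is at least four times their product
    nlinarith [sq_nonneg ((p₀ - p₁) * q₀ + p₀ * (q₀ - q₁)),
      mul_nonneg (sub_nonneg.2 h₀) (neg_nonneg.2 h)]

/-- Midpoint estimate for `√(p q - 1 / 2)`, where `p` and `q` satisfy the midpoint inequalities of
cosines of distances with factors `a` and `b`. The bound `C = a b ≥ (p₀ + p₁) (q₀ + q₁) / 4` makes
`C (p₀ + p₁) (q₀ + q₁) - 2 C ^ 2` smallest at `C = 1`. -/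
theorem add_sqrt_le_of_midpoint {p₀ p₁ q₀ q₁ p q a b : ℝ} (hp₀ : 0 < p₀) (hp₁ : 0 < p₁)
    (hq₀ : 0 < q₀) (hq₁ : 0 < q₁) (h₀ : 1 / 2 ≤ p₀ * q₀) (h₁ : 1 / 2 ≤ p₁ * q₁)
    (ha : 0 < a) (hb : 0 < b) (ha1 : a ≤ 1) (hb1 : b ≤ 1) (hp : p ≤ 1) (hq : q ≤ 1)
    (hpa : p₀ + p₁ ≤ 2 * a * p) (hqb : q₀ + q₁ ≤ 2 * b * q) :
    √(p₀ * q₀ - 1 / 2) + √(p₁ * q₁ - 1 / 2) ≤ 2 * (a * b) * √(p * q - 1 / 2) := by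
  have hK : (p₀ + p₁) * (q₀ + q₁) ≤ 4 * (a * b) * (p * q) := by
    have := mul_le_mul hpa hqb (by positivity) ((by positivity : 0 ≤ p₀ + p₁).trans hpa)
    linarith
  have hp0 : 0 < p := by
    by_contra! h
    nlinarith
  have hpq : p * q ≤ 1 := by nlinarith
  have hC : 0 < a * b := mul_pos ha hb
  have hC1 : a * b ≤ 1 := by nlinarith
  set C := a * b
  have hKC : (p₀ + p₁) * (q₀ + q₁) ≤ 4 * C := by nlinarith
  have hmain := two_mul_sqrt_mul_sqrt_le hp₀.le hp₁.le hq₀.le hq₁.le h₀ h₁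
  have s₀ := Real.sq_sqrt (sub_nonneg.2 h₀)
  have s₁ := Real.sq_sqrt (sub_nonneg.2 h₁)
  have hsq : (√(p₀ * q₀ - 1 / 2) + √(p₁ * q₁ - 1 / 2)) ^ 2 ≤ (2 * C) ^ 2 * (p * q - 1 / 2) := by
    calc (√(p₀ * q₀ - 1 / 2) + √(p₁ * q₁ - 1 / 2)) ^ 2
        ≤ (p₀ + p₁) * (q₀ + q₁) - 2 := by nlinarith
      _ ≤ C * ((p₀ + p₁) * (q₀ + q₁)) - 2 * C ^ 2 := by nlinarith
      _ ≤ (2 * C) ^ 2 * (p * q - 1 / 2) := by nlinarith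
  calc √(p₀ * q₀ - 1 / 2) + √(p₁ * q₁ - 1 / 2)
      ≤ √((2 * C) ^ 2 * (p * q - 1 / 2)) := Real.le_sqrt_of_sq_le hsq
    _ = 2 * C * √(p * q - 1 / 2) := by
      rw [Real.sqrt_mul (by positivity), Real.sqrt_sq (by positivity)]

/-- Sedrakyan's inequality, combined with a midpoint bound `C` on numerator and denominator. -/
theorem sq_div_le_of_midpoint {s s₀ s₁ c c₀ c₁ C : ℝ} (hC : 0 < C) (hc₀ : 0 < c₀) (hc₁ : 0 < c₁)
    (hs : 4 * C * s ^ 2 ≤ (s₀ + s₁) ^ 2) (hc : c₀ + c₁ ≤ 2 * C * c) :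
    2 * s ^ 2 / c ≤ (2 * s₀ ^ 2 / c₀ + 2 * s₁ ^ 2 / c₁) / 2 := by
  have hc0 : 0 < c := by
    by_contra! h
    nlinarith
  calc 2 * s ^ 2 / c ≤ (s₀ + s₁) ^ 2 / (c₀ + c₁) := by
        rw [div_le_div_iff₀ hc0 (by positivity)]
        calc 2 * s ^ 2 * (c₀ + c₁) ≤ 2 * s ^ 2 * (2 * C * c) := by gcongr
          _ = 4 * C * s ^ 2 * c := by ring
          _ ≤ (s₀ + s₁) ^ 2 * c := by gcongr
    _ ≤ s₀ ^ 2 / c₀ + s₁ ^ 2 / c₁ := by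
        rw [div_add_div _ _ hc₀.ne' hc₁.ne', div_le_div_iff₀ (by positivity) (by positivity)]
        linear_combination sq_nonneg (s₀ * c₁ - s₁ * c₀)
    _ = (2 * s₀ ^ 2 / c₀ + 2 * s₁ ^ 2 / c₁) / 2 := by ring

/-! ### Convexity of the replacement function -/

theorem half_lt_cosK_mul_cosK {κ : ℝ} (hκ : 0 < κ) {r a b : ℝ} (hr : r < modelDiam κ / 4)
    (ha : 0 ≤ a) (har : a ≤ r) (hb : 0 ≤ b) (hbr : b ≤ r) :
    1 / 2 < cosK κ a * cosK κ b := by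
  have hk : 0 < √κ := Real.sqrt_pos.2 hκ
  have hkr : √κ * r < Real.pi / 4 := by
    rw [modelDiam, div_div, lt_div_iff₀ (by positivity)] at hr
    linarith
  have key : ∀ c : ℝ, 0 ≤ c → c ≤ r → √2 / 2 < cosK κ c := by
    intro c hc hcr
    rw [← Real.cos_pi_div_four]
    refine Real.cos_lt_cos_of_nonneg_of_le_pi (by positivity) (by linarith [Real.pi_pos]) ?_
    exact (mul_le_mul_of_nonneg_left hcr hk.le).trans_lt hkr
  calc (1 / 2 : ℝ) = √2 / 2 * (√2 / 2) := by
        rw [div_mul_div_comm, Real.mul_self_sqrt zero_le_two]; norm_num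
    _ < cosK κ a * cosK κ b :=
        mul_lt_mul'' (key a ha har) (key b hb hbr) (by positivity) (by positivity)

theorem sqrt_mul_dist_lt {X : Type*} [MetricSpace X] {κ : ℝ} (hκ : 0 < κ) {o : X} {r : ℝ}
    (hr : r < modelDiam κ / 4) {x y : X} (hx : dist x o ≤ r) (hy : dist y o ≤ r) :
    √κ * dist x y < Real.pi / 2 := by
  have hk : 0 < √κ := Real.sqrt_pos.2 hκ
  rw [modelDiam, div_div, lt_div_iff₀ (by positivity)] at hr
  have := mul_le_mul_of_nonneg_left (dist_triangle_right x y o) hk.le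
  nlinarith

/-- Midpoint convexity of the replacement function along a pair of geodesics in the ball. -/
theorem IsCAT.convexReplacement_midpoint_le {X : Type*} [MetricSpace X] {κ : ℝ} (hκ : 0 < κ)
    (hX : IsCAT κ X) {o : X} {r : ℝ} (hr : r < modelDiam κ / 4) {α β : ℝ → X}
    (hα : IsGeodesic α) (hβ : IsGeodesic β) (hαr : ∀ t ∈ Set.Icc (0 : ℝ) 1, dist (α t) o ≤ r)
    (hβr : ∀ t ∈ Set.Icc (0 : ℝ) 1, dist (β t) o ≤ r) :
    convexReplacement κ o (α (1 / 2)) (β (1 / 2))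
      ≤ (convexReplacement κ o (α 0) (β 0) + convexReplacement κ o (α 1) (β 1)) / 2 := by
  have hpi := Real.pi_pos
  have i0 : (0 : ℝ) ∈ Set.Icc (0 : ℝ) 1 := by norm_num
  have i1 : (1 : ℝ) ∈ Set.Icc (0 : ℝ) 1 := by norm_num
  have ih : (1 / 2 : ℝ) ∈ Set.Icc (0 : ℝ) 1 := by norm_num
  have hr0 : 0 ≤ r := dist_nonneg.trans (hαr 0 i0)
  have hball : ∀ x ∈ ({α 0, α (1 / 2), α 1, β 0, β (1 / 2), β 1} : Set X), dist x o ≤ r := by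
    simp only [Set.mem_insert_iff, Set.mem_singleton_iff]
    rintro x (rfl | rfl | rfl | rfl | rfl | rfl)
    exacts [hαr _ i0, hαr _ ih, hαr _ i1, hβr _ i0, hβr _ ih, hβr _ i1]
  have hd : ∀ x y : X, dist x o ≤ r → dist y o ≤ r → √κ * dist x y < Real.pi / 2 :=
    fun x y hx hy => sqrt_mul_dist_lt hκ hr hx hy
  have hod : dist o o ≤ r := by simpa using hr0
  have hpos : ∀ x : X, dist x o ≤ r → 0 < cosK κ (dist x o) := fun x hx =>
    cosK_pos_of_lt (by positivity) (hd x o hx hod)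
  have hhalf : ∀ x y : X, dist x o ≤ r → dist y o ≤ r →
      0 < Real.cos (√κ * dist x y / 2) := by
    intro x y hx hy
    have h0 : 0 ≤ √κ * dist x y := by positivity
    have := hd x y hx hy
    exact Real.cos_pos_of_mem_Ioo ⟨by linarith, by linarith⟩
  have hH : ∀ t ∈ Set.Icc (0 : ℝ) 1,
      1 / 2 < cosK κ (dist (α t) o) * cosK κ (dist (β t) o) := fun t ht =>
    half_lt_cosK_mul_cosK hκ hr dist_nonneg (hαr t ht) dist_nonneg (hβr t ht)
  have hp := hX.cosK_dist_half hκ hα (w := o) (hd _ _ (hαr _ i0) (hαr _ i1))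
    (hd _ _ hod (hαr _ i0)) (hd _ _ hod (hαr _ i1))
  have hq := hX.cosK_dist_half hκ hβ (w := o) (hd _ _ (hβr _ i0) (hβr _ i1))
    (hd _ _ hod (hβr _ i0)) (hd _ _ hod (hβr _ i1))
  simp only [dist_comm o] at hp hq
  simp only [convexReplacement, cosK_dist_eq κ (α _) (β _), sub_sub_cancel]
  exact sq_div_le_of_midpoint
    (mul_pos (hhalf _ _ (hαr _ i0) (hαr _ i1)) (hhalf _ _ (hβr _ i0) (hβr _ i1)))
    (Real.sqrt_pos.2 (sub_pos.2 (hH 0 i0))) (Real.sqrt_pos.2 (sub_pos.2 (hH 1 i1)))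
    (hX.halfChord_midpoint_sq_le hκ hα hβ fun x hx y hy => hd x y (hball x hx) (hball y hy))
    (add_sqrt_le_of_midpoint (hpos _ (hαr _ i0)) (hpos _ (hαr _ i1)) (hpos _ (hβr _ i0))
      (hpos _ (hβr _ i1)) (hH 0 i0).le (hH 1 i1).le (hhalf _ _ (hαr _ i0) (hαr _ i1))
      (hhalf _ _ (hβr _ i0) (hβr _ i1)) (Real.cos_le_one _) (Real.cos_le_one _)
      (Real.cos_le_one _) (Real.cos_le_one _) hp hq)

/-- The product `B × B` of the closed ball `B` with itself carries the `ℓ²` product metric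
`√(d(x, x')² + d(y, y')²)`. The first conjunct says that the denominator of `Φ` is the square root
of a positive number, the second that `Φ` takes values in `[0, ∞)`. -/
theorem mainTheorem6 {X : Type*} [MetricSpace X] [CompleteSpace X] (κ : ℝ) (hκ : 0 < κ)
    (hX : IsCAT κ X) (o : X) (r : ℝ) (hr : r < modelDiam κ / 4) :
    (∀ x ∈ Metric.closedBall o r, ∀ y ∈ Metric.closedBall o r,
      0 < cosK κ (dist x o) * cosK κ (dist y o) - 1 / 2) ∧
    (∀ x ∈ Metric.closedBall o r, ∀ y ∈ Metric.closedBall o r,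
      0 ≤ convexReplacement κ o x y) ∧
    GeodesicallyConvex
      (fun p : WithLp 2 (Metric.closedBall o r × Metric.closedBall o r) =>
        convexReplacement κ o (p.fst : X) (p.snd : X)) := by
  have hH : ∀ x ∈ Metric.closedBall o r, ∀ y ∈ Metric.closedBall o r,
      0 < cosK κ (dist x o) * cosK κ (dist y o) - 1 / 2 := fun x hx y hy =>
    sub_pos.2 (half_lt_cosK_mul_cosK hκ hr dist_nonneg hx dist_nonneg hy)
  refine ⟨hH, fun x _ y _ => div_nonneg (sub_nonneg.2 (Real.cos_le_one _)) (Real.sqrt_nonneg _),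
    fun γ hγ => ?_⟩
  have hα : IsGeodesic (fun t => ((γ t).fst : X)) := hγ.fst_snd.1
  have hβ : IsGeodesic (fun t => ((γ t).snd : X)) := hγ.fst_snd.2
  refine convexOn_Icc_of_midpoint ?_ fun x hx y hy => ?_
  · have hαc : ContinuousOn (fun t => ((γ t).fst : X)) (Set.Icc 0 1) := hα.continuousOn
    have hβc : ContinuousOn (fun t => ((γ t).snd : X)) (Set.Icc 0 1) := hβ.continuousOn
    have hcos : Continuous (cosK κ) := by unfold cosK; fun_prop
    refine ContinuousOn.div ?_ ?_ fun t _ =>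
      (Real.sqrt_pos.2 (hH _ (γ t).fst.2 _ (γ t).snd.2)).ne'
    · exact continuousOn_const.sub
        (hcos.comp_continuousOn (continuous_dist.comp_continuousOn (hαc.prodMk hβc)))
    · exact (((hcos.comp_continuousOn
          (continuous_dist.comp_continuousOn (hαc.prodMk continuousOn_const))).mul
        (hcos.comp_continuousOn
          (continuous_dist.comp_continuousOn (hβc.prodMk continuousOn_const)))).sub
            continuousOn_const).sqrt
  · have h := hX.convexReplacement_midpoint_le hκ hr (hα.reparam hx hy) (hβ.reparam hx hy)
      (fun t _ => (γ _).fst.2) (fun t _ => (γ _).snd.2)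
    simpa [show x + 1 / 2 * (y - x) = (x + y) / 2 by ring,
      show x + 2⁻¹ * (y - x) = (x + y) / 2 by ring] using h
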